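/- For a nonempty set $V\subseteq\mathbb{C}^{n}$ (with the Euclidean norm) and $\rho>0$, let $N_V(\rho)$ be the least $k\in\mathbb{N}$ such that $V$ is covered by $k$ open balls of radius $\rho$ centered at points of $V$ (with $N_V(\rho)=\infty$ if there is no such $k$), let $$\underline{\dim}_{\mathrm B}(V)=\liminf_{\rho\to 0^+}\frac{\log N_V(\rho)}{\log(1/\rho)},$$ and, for nonempty $U\subseteq\mathbb{C}^{n}$, let the lower modified Minkowski dimension of $U$ be $$\underline{\dim}_{\mathrm{MB}}(U)=\inf\Big\{\sup_{i\in\mathbb{N}}\underline{\dim}_{\mathrm B}(U_i): U\subseteq\bigcup_{i\in\mathbb{N}}U_i\Big\},$$ where the infimum is over all coverings $\{U_i\}_{i\in\mathbb{N}}$ of $U$ by nonempty compact sets $U_i\subseteq\mathbb{C}^n$. **Theorem.** Let $U\subseteq\mathbb{C}^{p+q}$ be nonempty with $\underline{\dim}_{\mathrm{MB}}(U)<2m$, and let $B\in\mathbb{C}^{m\times q}$, with $m\ge q$, be a full-rank matrix. Then $$\ker[A\ \ B]\cap(U\setminus\{0\})=\emptyset$$ for Lebesgue-almost all $A\in\mathbb{C}^{m\times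 p}$, where $[A\ \ B]\in\mathbb{C}^{m\times(p+q)}$ is the matrix whose columns are those of $A$ followed by those of $B$. -/

import Mathlib

open MeasureTheory Filter Topology

noncomputable section

/-- The covering number of `U` for radius `ρ`: the least `k` such that `U` is covered by `k` open
balls of radius `ρ` centered at points of `U` (and `∞` if there is no such `k`). -/
def ballCoveringNumber {E : Type*} [PseudoMetricSpace E] (U : Set E) (ρ : ℝ) : ℕ∞ :=
  sInf {n : ℕ∞ | ∃ k : ℕ, n = k ∧
    ∃ u : Fin k → E, (∀ i, u i ∈ U) ∧ U ⊆ ⋃ i, Metric.ball (u i) ρ}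

/-- The lower Minkowski (box-counting) dimension
`liminf_{ρ → 0, ρ > 0} log N_U(ρ) / log (1 / ρ)`, an extended real number. -/
def lowerMinkowskiDim {E : Type*} [PseudoMetricSpace E] (U : Set E) : EReal :=
  liminf (fun ρ : ℝ => ENNReal.log (ballCoveringNumber U ρ : ENNReal) /
    ((Real.log (1 / ρ) : ℝ) : EReal)) (𝓝[>] (0 : ℝ))

/-- The lower modified Minkowski dimension: the infimum of `sup_i lowerMinkowskiDim (V i)` over all
countable coverings of `U` by nonempty compact sets `V i`. -/
def lowerModifiedMinkowskiDim {E : Type*} [PseudoMetricSpace E] (U : Set E) : EReal :=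
  sInf {d : EReal | ∃ V : ℕ → Set E, (∀ i, (V i).Nonempty ∧ IsCompact (V i)) ∧
    U ⊆ ⋃ i, V i ∧ d = ⨆ i, lowerMinkowskiDim (V i)}

/-- The block matrix `[A B]` with the columns of `A` followed by those of `B`. -/
def Matrix.hconcat {m p q : ℕ} (A : Matrix (Fin m) (Fin p) ℂ) (B : Matrix (Fin m) (Fin q) ℂ) :
    Matrix (Fin m) (Fin (p + q)) ℂ :=
  Matrix.of fun i => Fin.append (A i) (B i)

end

/-! Since `B` is injective, a nonzero kernel vector `x` of `[A B]` has some coordinate `x j ≠ 0`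
with `j < p`. For fixed such `x`, each of the `m` rows of `[A B] x = 0` confines one entry of that
row of `A` to a point, so solving up to error `O(ρ)` costs volume `O(ρ²)` per row and `O(ρ^(2m))` in
all (`volume_box_inter_slab_le`). A cover of a piece of `U` by `k` balls of radius `ρ` therefore
bounds the volume of bad bounded `A` by `O(k ρ^(2m))`. Dimension below `2m` makes this arbitrarily
small along suitable `ρ → 0` (`measure_eq_zero_of_lowerMinkowskiDim_lt`). Countably many such null
sets exhaust all bad `A`. -/

/-- In a box of `ℂ^p`, the slab `‖⟨a, y⟩ + b‖ ≤ δ` has volume `O(δ²)`, uniformly over all `b` and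
all `y` with a coordinate bounded away from zero. -/
lemma volume_box_inter_slab_le {p : ℕ} (y : Fin p → ℂ) (j : Fin p) {c : ℝ} (hc : 0 < c)
    (hy : c ≤ ‖y j‖) (b : ℂ) (R δ : ℝ) :
    volume {a : Fin p → ℂ | (∀ k, ‖a k‖ ≤ R) ∧ ‖∑ k, a k * y k + b‖ ≤ δ} ≤
      (ENNReal.ofReal R ^ 2 * NNReal.pi) ^ (p - 1) *
        (ENNReal.ofReal (δ / c) ^ 2 * NNReal.pi) := by
  obtain _ | n := p
  · exact j.elim0
  have hyj : 0 < ‖y j‖ := hc.trans_le hy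
  let box : Set (Fin n → ℂ) := Set.univ.pi fun _ => Metric.closedBall 0 R
  let T : Set (ℂ × (Fin n → ℂ)) :=
    {x | x.2 ∈ box ∧ ‖x.1 * y j + (∑ k, x.2 k * y (j.succAbove k) + b)‖ ≤ δ}
  have hbox : MeasurableSet box := .univ_pi fun _ => Metric.isClosed_closedBall.measurableSet
  have hT : MeasurableSet T := by
    have hclosed : IsClosed {x : ℂ × (Fin n → ℂ) |
        ‖x.1 * y j + (∑ k, x.2 k * y (j.succAbove k) + b)‖ ≤ δ} :=
      isClosed_le (by fun_prop) continuous_const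
    exact (measurable_snd hbox).inter hclosed.measurableSet
  -- With the other coordinates fixed, the slab condition puts the `j`-th one in a disc of radius `δ
  -- / ‖y j‖ ≤ δ / c`; Fubini then integrates over the box.
  have hslice (w : Fin n → ℂ) : volume ((fun z => (z, w)) ⁻¹' T) ≤
      box.indicator (fun _ => ENNReal.ofReal (δ / c) ^ 2 * NNReal.pi) w := by
    by_cases hw : w ∈ box
    · rw [Set.indicator_of_mem hw, ← Complex.volume_closedBall
        (-(∑ k, w k * y (j.succAbove k) + b) / y j)]
      refine measure_mono fun z hz => ?_
      have hz' : ‖z * y j + (∑ k, w k * y (j.succAbove k) + b)‖ ≤ δ := hz.2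
      have hδ : 0 ≤ δ := (norm_nonneg _).trans hz'
      have hne : y j ≠ 0 := norm_pos_iff.1 hyj
      rw [Metric.mem_closedBall, dist_eq_norm]
      have : z - -(∑ k, w k * y (j.succAbove k) + b) / y j =
          (z * y j + (∑ k, w k * y (j.succAbove k) + b)) / y j := by
        field_simp
        ring
      rw [this, norm_div]
      gcongr
    · have : (fun z => (z, w)) ⁻¹' T = ∅ := Set.eq_empty_of_forall_notMem fun z hz => hw hz.1
      simp [this]
  calc volume {a : Fin (n + 1) → ℂ | (∀ k, ‖a k‖ ≤ R) ∧ ‖∑ k, a k * y k + b‖ ≤ δ}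
      ≤ volume (MeasurableEquiv.piFinSuccAbove (fun _ => ℂ) j ⁻¹' T) := by
        refine measure_mono fun a ha => ⟨fun k _ => ?_, ?_⟩
        · simpa using! ha.1 (j.succAbove k)
        · have := ha.2
          rw [Fin.sum_univ_succAbove _ j, add_assoc] at this
          exact this
    _ = volume T := (volume_preserving_piFinSuccAbove (fun _ => ℂ) j).measure_preimage
        hT.nullMeasurableSet
    _ = ∫⁻ w, volume ((fun z => (z, w)) ⁻¹' T) := Measure.prod_apply_symm hT
    _ ≤ ∫⁻ w, box.indicator (fun _ => ENNReal.ofReal (δ / c) ^ 2 * NNReal.pi) w :=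
        lintegral_mono hslice
    _ = _ := by
        rw [lintegral_indicator_const hbox, mul_comm, volume_pi_pi]
        simp [Complex.volume_closedBall]

/-- A set whose measure is `O(k ρ ^ d)` whenever `k` balls of radius `ρ` centered in `K` cover `K`
is null if the lower Minkowski dimension of `K` is less than `d`. -/
lemma measure_eq_zero_of_lowerMinkowskiDim_lt {E α : Type*} [PseudoMetricSpace E]
    [MeasurableSpace α] {μ : Measure α} {K : Set E} {S : Set α} {d : ℕ} {C : ENNReal}
    (hC : C ≠ ⊤) (hK : lowerMinkowskiDim K < (d : EReal))
    (h : ∀ ρ : ℝ, 0 < ρ → ∀ (k : ℕ) (u : Fin k → E), (∀ i, u i ∈ K) →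
      K ⊆ ⋃ i, Metric.ball (u i) ρ → μ S ≤ k * (C * ENNReal.ofReal ρ ^ d)) :
    μ S = 0 := by
  obtain ⟨s, hs, hsd⟩ := EReal.lt_iff_exists_real_btwn.1 hK
  have hsd' : 0 < (d : ℝ) - s := sub_pos.2 (by exact_mod_cast hsd)
  have hlim : Tendsto (fun ρ : ℝ => C * ENNReal.ofReal (ρ ^ ((d : ℝ) - s))) (𝓝[>] 0) (𝓝 0) := by
    have h1 : Tendsto (fun ρ : ℝ => ρ ^ ((d : ℝ) - s)) (𝓝[>] 0) (𝓝 0) := by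
      have := (Real.continuousAt_rpow_const 0 ((d : ℝ) - s) (Or.inr hsd'.le)).tendsto
      rw [Real.zero_rpow hsd'.ne'] at this
      exact this.mono_left nhdsWithin_le_nhds
    have h2 := ENNReal.Tendsto.const_mul (ENNReal.tendsto_ofReal h1) (Or.inr hC)
    simpa using h2
  -- A liminf controls only some arbitrarily small `ρ`; this suffices because `μ S` does not depend
  -- on `ρ`.
  have hfreq := frequently_lt_of_liminf_lt (by isBoundedDefault) hs
  have hev : ∀ᶠ ρ : ℝ in 𝓝[>] 0, ρ ∈ Set.Ioo (0 : ℝ) 1 := Ioo_mem_nhdsGT one_pos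
  refine le_antisymm (ge_of_tendsto_of_frequently hlim
    ((hfreq.and_eventually hev).mono ?_)) zero_le
  rintro ρ ⟨hρ, hρ0, hρ1⟩
  have hlog : 0 < Real.log (1 / ρ) := Real.log_pos (by rw [lt_div_iff₀ hρ0]; linarith)
  rw [EReal.div_lt_iff (by exact_mod_cast hlog) (EReal.coe_ne_top _)] at hρ
  have hN : (ballCoveringNumber K ρ : ENNReal) ≤ ENNReal.ofReal (ρ ^ (-s)) := by
    rw [← ENNReal.log_le_log_iff, ENNReal.log_ofReal_of_pos (Real.rpow_pos_of_pos hρ0 _),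
      Real.log_rpow hρ0]
    refine hρ.le.trans (le_of_eq ?_)
    rw [one_div, Real.log_inv, ← EReal.coe_mul]
    congr 1
    ring
  -- A finite cover exists, since otherwise the covering number would be `sInf ∅ = ⊤`, against `hN`.
  have hne : {n : ℕ∞ | ∃ k : ℕ, n = k ∧
      ∃ u : Fin k → E, (∀ i, u i ∈ K) ∧ K ⊆ ⋃ i, Metric.ball (u i) ρ}.Nonempty := by
    by_contra hemp
    rw [Set.not_nonempty_iff_eq_empty] at hemp
    have : ballCoveringNumber K ρ = ⊤ := by rw [ballCoveringNumber, hemp, sInf_empty]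
    rw [this] at hN
    simp at hN
  obtain ⟨k, hk, u, hu, hcov⟩ := csInf_mem hne
  have hk' : ballCoveringNumber K ρ = k := hk
  rw [hk', ENat.toENNReal_coe] at hN
  calc μ S ≤ k * (C * ENNReal.ofReal ρ ^ d) := h ρ hρ0 k u hu hcov
    _ ≤ ENNReal.ofReal (ρ ^ (-s)) * (C * ENNReal.ofReal ρ ^ d) := by gcongr
    _ = C * (ENNReal.ofReal (ρ ^ (-s)) * ENNReal.ofReal (ρ ^ d)) := by
        rw [ENNReal.ofReal_pow hρ0.le]; ring
    _ = C * ENNReal.ofReal (ρ ^ ((d : ℝ) - s)) := by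
        rw [← ENNReal.ofReal_mul (Real.rpow_nonneg hρ0.le _), ← Real.rpow_natCast,
          ← Real.rpow_add hρ0, neg_add_eq_sub]

lemma Matrix.hconcat_mulVec {m p q : ℕ} (A : Matrix (Fin m) (Fin p) ℂ)
    (B : Matrix (Fin m) (Fin q) ℂ) (x : Fin (p + q) → ℂ) (i : Fin m) :
    (Matrix.hconcat A B).mulVec x i =
      ∑ k, A i k * x (Fin.castAdd q k) + B.mulVec (fun k => x (Fin.natAdd p k)) i := by
  simp [Matrix.mulVec, dotProduct, Matrix.hconcat, Fin.sum_univ_add]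

/-- Bounded matrices `A` for which some `x ∈ K` with `‖x j‖ ≥ c`, where `j` is one of the first
`p` coordinates, lies in the kernel of `[A B]` form a null set. -/
lemma volume_bounded_hconcat_kernel_eq_zero {m p q : ℕ} {K : Set (EuclideanSpace ℂ (Fin (p + q)))}
    (hK : lowerMinkowskiDim K < ((2 * m : ℕ) : EReal)) (B : Matrix (Fin m) (Fin q) ℂ)
    (j : Fin p) {c : ℝ} (hc : 0 < c) {R : ℝ} (hR : 0 ≤ R) :
    volume {A : Fin m → Fin p → ℂ | (∀ i k, ‖A i k‖ ≤ R) ∧ ∃ x ∈ K,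
      c ≤ ‖x (Fin.castAdd q j)‖ ∧
        (Matrix.hconcat (Matrix.of A) B).mulVec x.ofLp = 0} = 0 := by
  -- A Lipschitz constant for every row of `[A B]`, uniform over all `A` with entries bounded by
  -- `R`.
  set M : ℝ := p * R + ∑ i, ∑ k, ‖B i k‖ with hM
  have hM0 : 0 ≤ M := by positivity
  have hrow (A : Fin m → Fin p → ℂ) (hA : ∀ i k, ‖A i k‖ ≤ R) (i : Fin m)
      (z : EuclideanSpace ℂ (Fin (p + q))) :
      ‖(Matrix.hconcat (Matrix.of A) B).mulVec z.ofLp i‖ ≤ M * ‖z‖ := by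
    rw [Matrix.hconcat_mulVec, hM, add_mul]
    refine (norm_add_le _ _).trans (add_le_add ?_ ?_)
    · refine (norm_sum_le _ _).trans ?_
      calc ∑ k, ‖Matrix.of A i k * z (Fin.castAdd q k)‖ ≤ ∑ _k : Fin p, R * ‖z‖ := by
            refine Finset.sum_le_sum fun k _ => ?_
            rw [norm_mul]
            exact mul_le_mul (hA i k) (PiLp.norm_apply_le z _) (norm_nonneg _) hR
        _ = p * R * ‖z‖ := by simp [mul_assoc]
    · rw [Matrix.mulVec, dotProduct]
      refine (norm_sum_le _ _).trans ?_
      calc ∑ k, ‖B i k * z (Fin.natAdd p k)‖ ≤ ∑ k, ‖B i k‖ * ‖z‖ := by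
            refine Finset.sum_le_sum fun k _ => ?_
            rw [norm_mul]
            gcongr
            exact PiLp.norm_apply_le z _
        _ = (∑ k, ‖B i k‖) * ‖z‖ := by rw [Finset.sum_mul]
        _ ≤ _ := by
            gcongr
            exact Finset.single_le_sum (f := fun i => ∑ k, ‖B i k‖)
              (fun i _ => by positivity) (Finset.mem_univ i)
  set D : ENNReal := (ENNReal.ofReal R ^ 2 * NNReal.pi) ^ (p - 1) *
    (ENNReal.ofReal (M * 2 / c) ^ 2 * NNReal.pi) with hD
  have hDtop : D ≠ ⊤ := by finiteness
  refine measure_eq_zero_of_lowerMinkowskiDim_lt (C := D ^ m) (by finiteness) hK ?_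
  intro ρ hρ k u _ hcov
  let piece (l : Fin k) : Set (Fin m → Fin p → ℂ) := {A | (∀ i k, ‖A i k‖ ≤ R) ∧
    ∃ x ∈ Metric.ball (u l) ρ, c ≤ ‖x (Fin.castAdd q j)‖ ∧
      (Matrix.hconcat (Matrix.of A) B).mulVec x.ofLp = 0}
  have hpiece (l : Fin k) : volume (piece l) ≤ D ^ m * ENNReal.ofReal ρ ^ (2 * m) := by
    -- The center `u l` may violate the lower bound `c`, so the ball is recentered at a point `x₀`
    -- that satisfies it; this doubles the radius.
    by_cases hx : ∃ x₀ ∈ Metric.ball (u l) ρ, c ≤ ‖x₀ (Fin.castAdd q j)‖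
    · obtain ⟨x₀, hx₀, hcx₀⟩ := hx
      let slab (i : Fin m) : Set (Fin p → ℂ) := {a | (∀ k, ‖a k‖ ≤ R) ∧
        ‖∑ k, a k * x₀ (Fin.castAdd q k) + B.mulVec (fun k => x₀ (Fin.natAdd p k)) i‖ ≤
          M * (2 * ρ)}
      -- The kernel vector `x` depends on `A`, but `[A B] x₀ = [A B] (x₀ - x)` is small, a condition
      -- on the fixed `x₀` that splits over the rows of `A`.
      have hsub : piece l ⊆ Set.univ.pi slab := by
        rintro A ⟨hA, x, hx, -, hker⟩ i -
        refine ⟨hA i, ?_⟩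
        have hdist : ‖x₀ - x‖ ≤ 2 * ρ := by
          rw [← dist_eq_norm]
          have := dist_triangle_right x₀ x (u l)
          rw [Metric.mem_ball] at hx hx₀
          linarith
        have h0 : (Matrix.hconcat (Matrix.of A) B).mulVec (x₀ - x).ofLp =
            (Matrix.hconcat (Matrix.of A) B).mulVec x₀.ofLp := by
          rw [WithLp.ofLp_sub, Matrix.mulVec_sub, hker, sub_zero]
        have := hrow A hA i (x₀ - x)
        rw [h0, Matrix.hconcat_mulVec] at this
        exact this.trans (by gcongr)
      have hslab (i : Fin m) : volume (slab i) ≤ D * ENNReal.ofReal ρ ^ 2 := by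
        refine (volume_box_inter_slab_le _ j hc hcx₀ _ R _).trans (le_of_eq ?_)
        rw [show M * (2 * ρ) / c = M * 2 / c * ρ by ring, ENNReal.ofReal_mul (by positivity), hD]
        ring
      calc volume (piece l) ≤ volume (Set.univ.pi slab) := measure_mono hsub
        _ = ∏ i, volume (slab i) := volume_pi_pi _
        _ ≤ ∏ _i : Fin m, D * ENNReal.ofReal ρ ^ 2 := Finset.prod_le_prod' fun i _ => hslab i
        _ = D ^ m * ENNReal.ofReal ρ ^ (2 * m) := by
            simp [mul_pow, pow_mul]
    · have : piece l = ∅ :=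
        Set.eq_empty_of_forall_notMem fun A ⟨_, x, hxb, hcx, _⟩ => hx ⟨x, hxb, hcx⟩
      simp [this]
  calc volume _ ≤ volume (⋃ l, piece l) := by
        refine measure_mono ?_
        rintro A ⟨hA, x, hxK, hcx, hker⟩
        obtain ⟨l, hl⟩ := Set.mem_iUnion.1 (hcov hxK)
        exact Set.mem_iUnion.2 ⟨l, hA, x, hl, hcx, hker⟩
    _ ≤ ∑ l, volume (piece l) := measure_iUnion_fintype_le _ _
    _ ≤ ∑ _l : Fin k, D ^ m * ENNReal.ofReal ρ ^ (2 * m) := Finset.sum_le_sum fun l _ => hpiece l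
    _ = k * (D ^ m * ENNReal.ofReal ρ ^ (2 * m)) := by simp

lemma Matrix.eq_zero_of_mulVec_eq_zero_of_rank_eq_width {m q : ℕ} {B : Matrix (Fin m) (Fin q) ℂ}
    (hB : B.rank = q) {z : Fin q → ℂ} (hz : B.mulVec z = 0) : z = 0 := by
  have h := B.mulVecLin.finrank_range_add_finrank_ker
  rw [Module.finrank_fin_fun] at h
  have hker : Module.finrank ℂ (LinearMap.ker B.mulVecLin) = 0 := by
    have : Module.finrank ℂ (LinearMap.range B.mulVecLin) = q := hB
    omega
  exact (Submodule.mem_bot ℂ).1 (Submodule.finrank_eq_zero.1 hker ▸ LinearMap.mem_ker.2 hz)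

/-- A nonzero kernel vector of `[A B]` with `B` injective has a nonzero coordinate among the first
`p` ones. -/
lemma Matrix.exists_castAdd_ne_zero_of_hconcat_mulVec_eq_zero {m p q : ℕ}
    {A : Matrix (Fin m) (Fin p) ℂ} {B : Matrix (Fin m) (Fin q) ℂ} (hB : B.rank = q)
    {x : Fin (p + q) → ℂ} (hx : x ≠ 0) (hker : (Matrix.hconcat A B).mulVec x = 0) :
    ∃ j, x (Fin.castAdd q j) ≠ 0 := by
  by_contra! hzero
  refine hx ?_
  have hz : (fun k => x (Fin.natAdd p k)) = 0 := by
    refine Matrix.eq_zero_of_mulVec_eq_zero_of_rank_eq_width hB (funext fun i => ?_)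
    simpa [hzero] using (Matrix.hconcat_mulVec A B x i).symm.trans (congrFun hker i)
  ext l
  exact Fin.addCases hzero (fun k => congrFun hz k) l

/-- Almost all `A` is with respect to Lebesgue measure on `ℂ^{m × p}`, i.e. the product `volume` on
`Fin m → Fin p → ℂ`. -/
theorem mainTheorem1 (m p q : ℕ) (U : Set (EuclideanSpace ℂ (Fin (p + q)))) (hU : U.Nonempty)
    (hdim : lowerModifiedMinkowskiDim U < ((2 * m : ℕ) : EReal))
    (B : Matrix (Fin m) (Fin q) ℂ) (hmq : q ≤ m) (hB : B.rank = min m q) :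
    ∀ᵐ A : Fin m → Fin p → ℂ ∂volume,
      (LinearMap.ker (Matrix.toEuclideanLin (Matrix.hconcat (Matrix.of A) B)) :
        Set (EuclideanSpace ℂ (Fin (p + q)))) ∩ (U \ {0}) = ∅ := by
  rw [min_eq_right hmq] at hB
  obtain ⟨_, ⟨V, -, hUV, rfl⟩, hlt⟩ := sInf_lt_iff.1 hdim
  have hV (i : ℕ) : lowerMinkowskiDim (V i) < ((2 * m : ℕ) : EReal) := (le_iSup _ i).trans_lt hlt
  -- Countable exhaustion: `n` indexes the covering pieces, `j` the nonzero coordinate, `1 / (L +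
  -- 1)` its lower bound and `R` the bound on `A`.
  have hnull (n : ℕ) (j : Fin p) (L R : ℕ) : ∀ᵐ A : Fin m → Fin p → ℂ ∂volume,
      ¬ ((∀ i k, ‖A i k‖ ≤ (R : ℝ)) ∧ ∃ x ∈ V n, 1 / ((L : ℝ) + 1) ≤ ‖x (Fin.castAdd q j)‖ ∧
        (Matrix.hconcat (Matrix.of A) B).mulVec x.ofLp = 0) := by
    rw [ae_iff]
    simpa only [not_not] using volume_bounded_hconcat_kernel_eq_zero (hV n) B j
      (Nat.one_div_pos_of_nat (n := L)) (Nat.cast_nonneg R)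
  simp only [← ae_all_iff] at hnull
  filter_upwards [hnull] with A hA
  refine Set.eq_empty_of_forall_notMem ?_
  rintro x ⟨hker, hxU, hx0⟩
  have hker' : (Matrix.hconcat (Matrix.of A) B).mulVec x.ofLp = 0 := by
    rw [← Matrix.toLin'_apply, ← Matrix.ofLp_toLpLin 2 2]
    exact congrArg WithLp.ofLp (LinearMap.mem_ker.1 hker)
  obtain ⟨j, hj⟩ := Matrix.exists_castAdd_ne_zero_of_hconcat_mulVec_eq_zero hB
    (fun h => hx0 (WithLp.ofLp_injective 2 h)) hker'
  obtain ⟨n, hn⟩ := Set.mem_iUnion.1 (hUV hxU)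
  obtain ⟨L, hL⟩ := exists_nat_one_div_lt (norm_pos_iff.2 hj)
  obtain ⟨R, hR⟩ := exists_nat_ge ‖A‖
  exact hA n j L R ⟨fun i k => ((norm_le_pi_norm (A i) k).trans (norm_le_pi_norm A i)).trans hR,
    x, hn, hL.le, hker'⟩
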